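/- Let $A$ be a countable set with the discrete topology and $\sigma$-algebra, and let $\mathcal{X}^-$ be the set of left-infinite sequences $x=(\dots,x_{-2},x_{-1})$ in $A$. A probability kernel is a function $g(a|x)\ge 0$, $a\in A$, $x\in\mathcal{X}^-$, with $\sum_{a\in A}g(a|x)=1$ for all $x$ (for a left-infinite sequence ending at another coordinate, $g$ is applied after re-indexing). For $x\in\mathcal{X}^-$ let $P^x$ be the probability measure on $A^{\mathbb{N}}$ (product $\sigma$-algebra, $\mathbb N=\{0,1,\dots\}$) with $P^x([\omega_0^n])=\prod_{j=0}^n g(\omega_j|x\omega_0^{j-1})$ for all $\omega\in A^{\mathbb N}$ and $n\ge 0$, where $[\omega_0^n]$ is the set of sequences that start with $\omega_0,\dots,\omega_n$. For $j\ge 0$ put $$\mathrm{Var}_j(g)=\sup\Big\{\tfrac12\sum_{a\in A}|g(a|z)-g(a|z')| : z,z'\in\mathcal{X}^-,\ z_k=z'_k \text{ for } -j\le k\le -1\Big\},$$ and $\Gamma(g)=\prod_{j=0}^\infty(1-\mathrm{Var}_j(g))$. For $n\ge 0$, $f:A^{n+1}\to\mathbb{R}$ and $0\le j\le n$ let $$\delta_j(f)=\sup\{|f(\omega_0^{j-1}a\,\omega_{j+1}^n)-f(\omega_0^{j-1}b\,\omega_{j+1}^n)|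 : a,b\in A,\ \omega\in A^{n+1}\},\qquad \|\delta(f)\|_2^2=\sum_{j=0}^n\delta_j(f)^2;$$ let $\mathcal{L}$ be the set of all such $f$ (over all $n$) with $\delta_j(f)<\infty$ for all $j$, regarded as functions of the first $n+1$ coordinates on $A^{\mathbb{N}}$. A probability measure $\mu$ on $A^{\mathbb N}$ satisfies a Gaussian concentration bound (GCB) with constant $C>0$ if $\mathbb{E}_\mu[e^{f-\mathbb{E}_\mu[f]}]\le e^{C\|\delta(f)\|_2^2}$ for all $f\in\mathcal{L}$. Theorem. Let $g$ be a probability kernel with $\Gamma(g)>0$. Then for every $x\in\mathcal{X}^-$ the measure $P^x$ satisfies a GCB with constant $\Gamma(g)^{-2}/8$. More precisely, for all $f\in\mathcal{L}$, the function $f$ and all the exponentials below are $P^x$-integrable and, for all $\theta\in\mathbb{R}$, $$\sup_{x\in\mathcal{X}^-}\mathbb{E}_{P^x}\big[e^{\theta(f-\mathbb{E}_{P^x}[f])}\big]\le \exp\Big(\frac{\theta^2\,\Gamma(g)^{-2}}{8}\,\|\delta(f)\|_2^2\Big),$$ and, for all $u>0$, $$\sup_{x\in\mathcal{X}^-}P^x\big(|f-\mathbb{E}_{P^x}[f]|>u\big)\le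 2\exp\Big(-\frac{2u^2}{\Gamma(g)^{-2}\,\|\delta(f)\|_2^2}\Big),$$ where the last right-hand side is read as $0$ if $\|\delta(f)\|_2=0$. -/

import Mathlib

open MeasureTheory

namespace SCUM

/-- Left-infinite sequences `(…, x₋₂, x₋₁)` of symbols of `A`.  The value of `x : Past A` at `i`
is the symbol `x₋₍ᵢ₊₁₎`, so that `x 0` is the most recent symbol. -/
abbrev Past (A : Type*) := ℕ → A

/-- The left-infinite sequence `x σ₀ … σₙ₋₁`, again read backwards from its last symbol. -/
def Past.concat {A : Type*} (x : Past A) {n : ℕ} (σ : Fin n → A) : Past A :=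
  fun i => if h : i < n then σ ⟨n - 1 - i, by omega⟩ else x (i - n)

/-- A (shift-invariant) probability kernel `g(a | x)` on the alphabet `A`. No continuity or
measurability in the past is required. -/
structure ProbKernel (A : Type*) where
  toFun : A → Past A → ℝ
  nonneg : ∀ a x, 0 ≤ toFun a x
  hasSum_one : ∀ x, HasSum (fun a => toFun a x) 1

namespace ProbKernel

variable {A : Type*}

/-- `Var_j(g)`: the supremum over pairs of pasts that agree at the coordinates `-1, …, -j`
(all pairs if `j = 0`) of the total variation distance of the transition probabilities. -/
noncomputable def Var (g : ProbKernel A) (j : ℕ) : ℝ :=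
  sSup {v : ℝ | ∃ z z' : Past A, (∀ i < j, z i = z' i) ∧
    v = 1 / 2 * ∑' a, |g.toFun a z - g.toFun a z'|}

/-- `Γ(g) = ∏_{j ≥ 0} (1 - Var_j(g))`. -/
noncomputable def Gamma (g : ProbKernel A) : ℝ := ∏' j : ℕ, (1 - g.Var j)

lemma half_tsum_le_one (g : ProbKernel A) (z z' : Past A) :
    1 / 2 * ∑' a, |g.toFun a z - g.toFun a z'| ≤ 1 := by
  have hs : HasSum (fun a => g.toFun a z + g.toFun a z') (1 + 1) :=
    (g.hasSum_one z).add (g.hasSum_one z')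
  have hle : ∀ a, |g.toFun a z - g.toFun a z'| ≤ g.toFun a z + g.toFun a z' := fun a => by
    have h1 := g.nonneg a z
    have h2 := g.nonneg a z'
    rw [abs_le]
    constructor <;> linarith
  have hsum : Summable (fun a => |g.toFun a z - g.toFun a z'|) :=
    Summable.of_nonneg_of_le (fun a => abs_nonneg _) hle hs.summable
  have := hsum.tsum_le_tsum hle hs.summable
  rw [hs.tsum_eq] at this
  linarith

lemma Var_nonneg (g : ProbKernel A) (j : ℕ) : 0 ≤ g.Var j := by
  refine Real.sSup_nonneg ?_
  rintro v ⟨z, z', -, rfl⟩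
  have : 0 ≤ ∑' a, |g.toFun a z - g.toFun a z'| := tsum_nonneg fun a => abs_nonneg _
  linarith

lemma Var_le_one (g : ProbKernel A) (j : ℕ) : g.Var j ≤ 1 := by
  refine Real.sSup_le ?_ zero_le_one
  rintro v ⟨z, z', -, rfl⟩
  exact g.half_tsum_le_one z z'

/-- The product defining `Γ(g)` always converges (possibly to `0`). -/
lemma multipliable_one_sub_Var (g : ProbKernel A) : Multipliable fun j : ℕ => 1 - g.Var j := by
  have h0 : ∀ j, 0 ≤ 1 - g.Var j := fun j => by linarith [g.Var_le_one j]
  have h1 : ∀ j, 1 - g.Var j ≤ 1 := fun j => by linarith [g.Var_nonneg j]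
  refine ⟨⨅ s : Finset ℕ, ∏ j ∈ s, (1 - g.Var j), ?_⟩
  rw [HasProd, SummationFilter.unconditional_filter]
  refine tendsto_atTop_ciInf ?_ ⟨0, ?_⟩
  · intro s t hst
    exact Finset.prod_le_prod_of_subset_of_le_one hst (fun i _ => h0 i) (fun i _ _ => h1 i)
  · rintro _ ⟨s, rfl⟩
    exact Finset.prod_nonneg fun i _ => h0 i

/-- The law `g(· | z)` of the next symbol given the past `z`. -/
noncomputable def stepPMF (g : ProbKernel A) (z : Past A) : PMF A :=
  ⟨fun a => ENNReal.ofReal (g.toFun a z), by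
    have h := ENNReal.ofReal_tsum_of_nonneg (fun a => g.nonneg a z) (g.hasSum_one z).summable
    rw [(g.hasSum_one z).tsum_eq, ENNReal.ofReal_one] at h
    rw [h]
    exact ENNReal.summable.hasSum⟩

variable [Countable A] [MeasurableSpace A] [DiscreteMeasurableSpace A]

/-- The transition kernel from `σ₀, …, σₙ` to the symbol at time `n + 1`, for the past `x`:
it is `g(· | x σ₀ … σₙ)`. -/
noncomputable def transition (g : ProbKernel A) (x : Past A) (n : ℕ) :
    ProbabilityTheory.Kernel (Finset.Iic n → A) A where
  toFun σ := (g.stepPMF (x.concat fun i : Fin (n + 1) =>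
    σ ⟨i, Finset.mem_Iic.2 (Nat.lt_succ_iff.1 i.2)⟩)).toMeasure
  measurable' := measurable_of_countable _

instance (g : ProbKernel A) (x : Past A) (n : ℕ) :
    ProbabilityTheory.IsMarkovKernel (g.transition x n) :=
  ⟨fun _ => PMF.toMeasure.isProbabilityMeasure _⟩

/-- The probability measure `P^x` on `A^ℕ` of the chain specified by `g` and started with the fixed
past `x` (Ionescu-Tulcea): `ω₀` has law `g(· | x)`, and given `ω₀, …, ωₙ` the next symbol has law
`g(· | x ω₀ … ωₙ)`. -/
noncomputable def pastMeasure (g : ProbKernel A) (x : Past A) : Measure (ℕ → A) :=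
  ProbabilityTheory.Kernel.trajMeasure (X := fun _ => A) (g.stepPMF x).toMeasure (g.transition x)

instance (g : ProbKernel A) (x : Past A) : IsProbabilityMeasure (g.pastMeasure x) := by
  unfold pastMeasure
  infer_instance

open ProbabilityTheory ProbabilityTheory.Kernel Preorder in
/-- The cylinder formula `P^x([ω₀ … ωₙ]) = ∏_{j ≤ n} g(ω_j | x ω₀ … ω_{j-1})`. -/
lemma pastMeasure_cylinder (g : ProbKernel A) (x : Past A) (τ : ℕ → A) (n : ℕ) :
    g.pastMeasure x {ω | ∀ i ≤ n, ω i = τ i} =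
      ∏ j ∈ Finset.range (n + 1),
        ENNReal.ofReal (g.toFun (τ j) (x.concat fun i : Fin j => τ i)) := by
  induction n with
  | zero =>
    have hmap : (g.pastMeasure x).map (frestrictLe (π := fun _ => A) 0) =
        (g.stepPMF x).toMeasure.map
          (MeasurableEquiv.piUnique (fun _ : Finset.Iic 0 => A)).symm := by
      rw [pastMeasure, trajMeasure, Measure.map_comp _ _ (by fun_prop), traj_map_frestrictLe,
        partialTraj_self, Measure.id_comp]
    have hset : {ω : ℕ → A | ∀ i ≤ 0, ω i = τ i} =
        frestrictLe (π := fun _ => A) 0 ⁻¹' {σ | σ ⟨0, by simp⟩ = τ 0} := by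
      ext ω; simp
    have hx : (x.concat fun i : Fin 0 => τ i) = x := by
      funext i; simp [Past.concat]
    rw [hset, ← Measure.map_apply (by fun_prop) (Set.to_countable _).measurableSet, hmap,
      Measure.map_apply (by fun_prop) (Set.to_countable _).measurableSet]
    have : (MeasurableEquiv.piUnique (fun _ : Finset.Iic 0 => A)).symm ⁻¹'
        {σ | σ ⟨0, by simp⟩ = τ 0} = {τ 0} := by
      ext a; rfl
    rw [this, PMF.toMeasure_apply_singleton _ _ (measurableSet_singleton _)]
    simp [hx, stepPMF]
    rfl
  | succ n ih =>
    have h := map_frestrictLe_trajMeasure_compProd_eq_map_trajMeasure (X := fun _ => A)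
      (μ₀ := (g.stepPMF x).toMeasure) (κ := g.transition x) (a := n)
    change (g.pastMeasure x).map _ ⊗ₘ _ = (g.pastMeasure x).map _ at h
    let τ' : Finset.Iic n → A := fun i => τ i
    have hset : {ω : ℕ → A | ∀ i ≤ n + 1, ω i = τ i} =
        (fun ω : ℕ → A => (frestrictLe (π := fun _ => A) n ω, ω (n + 1))) ⁻¹'
          ({τ'} ×ˢ {τ (n + 1)}) := by
      ext ω
      simp only [Set.mem_ofPred_eq, Set.mem_preimage, Set.mem_prod, Set.mem_singleton_iff]
      constructor
      · intro hω
        exact ⟨funext fun i => hω i ((Finset.mem_Iic.1 i.2).trans n.le_succ), hω _ le_rfl⟩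
      · rintro ⟨h1, h2⟩ i hi
        rcases Nat.lt_or_ge n i with h' | h'
        · obtain rfl : i = n + 1 := by omega
          exact h2
        · exact congrFun h1 ⟨i, Finset.mem_Iic.2 h'⟩
    have hset' : {ω : ℕ → A | ∀ i ≤ n, ω i = τ i} =
        frestrictLe (π := fun _ => A) n ⁻¹' {τ'} := by
      ext ω
      simp only [Set.mem_ofPred_eq, Set.mem_preimage, Set.mem_singleton_iff]
      constructor
      · intro hω
        exact funext fun i => hω i (Finset.mem_Iic.1 i.2)
      · intro h1 i hi
        exact congrFun h1 ⟨i, Finset.mem_Iic.2 hi⟩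
    have hm : MeasurableSet ({τ'} ×ˢ {τ (n + 1)} : Set ((Finset.Iic n → A) × A)) :=
      (measurableSet_singleton _).prod (measurableSet_singleton _)
    rw [hset, ← Measure.map_apply (by fun_prop) hm, ← h, Measure.compProd_apply_prod
      (measurableSet_singleton _) (measurableSet_singleton _), lintegral_singleton,
      Measure.map_apply (by fun_prop) (measurableSet_singleton _), ← hset', ih,
      Finset.prod_range_succ _ (n + 1), mul_comm]
    congr 1
    change (g.stepPMF _).toMeasure _ = _
    rw [PMF.toMeasure_apply_singleton _ _ (measurableSet_singleton _)]
    rfl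

end ProbKernel

section GCB

variable {A : Type*}

/-- The absolute differences of `f` over pairs of strings that differ at most at the coordinate
`j`. -/
def oscSet {n : ℕ} (f : (Fin (n + 1) → A) → ℝ) (j : Fin (n + 1)) : Set ℝ :=
  {v | ∃ (ω : Fin (n + 1) → A) (a b : A),
    v = |f (Function.update ω j a) - f (Function.update ω j b)|}

/-- `δ_j(f)`. -/
noncomputable def delta {n : ℕ} (f : (Fin (n + 1) → A) → ℝ) (j : Fin (n + 1)) : ℝ :=
  sSup (oscSet f j)

/-- `f ∈ 𝓛ₙ`: all the `δ_j(f)` are finite. -/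
def FiniteOsc {n : ℕ} (f : (Fin (n + 1) → A) → ℝ) : Prop :=
  ∀ j, BddAbove (oscSet f j)

/-- `‖δ(f)‖₂²`. -/
noncomputable def deltaSq {n : ℕ} (f : (Fin (n + 1) → A) → ℝ) : ℝ :=
  ∑ j, delta f j ^ 2

/-- `f`, regarded as a function on `A^ℕ` of the coordinates `0, …, n`. -/
def onSeq {n : ℕ} (f : (Fin (n + 1) → A) → ℝ) : (ℕ → A) → ℝ :=
  fun ω => f fun i => ω i

/-- The measure `μ` on `A^ℕ` satisfies a Gaussian concentration bound with constant `C`. -/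
def SatisfiesGCB [MeasurableSpace A] (μ : Measure (ℕ → A)) (C : ℝ) : Prop :=
  0 < C ∧ ∀ (n : ℕ) (f : (Fin (n + 1) → A) → ℝ), FiniteOsc f →
    Integrable (onSeq f) μ ∧
    Integrable (fun ω => Real.exp (onSeq f ω - ∫ η, onSeq f η ∂μ)) μ ∧
    ∫ ω, Real.exp (onSeq f ω - ∫ η, onSeq f η ∂μ) ∂μ ≤ Real.exp (C * deltaSq f)

end GCB

end SCUM

/-! Run two copies of the chain from different pasts, coupling each step optimally. If the pasts
agree on their last `k` symbols, the next symbols differ with probability at most `g.Var k`, so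
disagreements are dominated by the falls to `0` of the house-of-cards chain, and one at time `m`
costs `δ_m(f)`. Hence changing the current symbol moves the conditional expectation of `f` by at
most `δ_0 + ∑ h_m δ_{m+1}`, where `h_m = hitProb g.Var 0 m` (`integral_sub_integral_le`). The
house-of-cards chain leaves `0` forever with probability `Γ`, so `1 + ∑ h_m ≤ Γ⁻¹`
(`one_add_sum_hitProb_le`).

Revealing the symbols one at a time and applying Hoeffding's lemma to each gives a sum of squares of
such oscillations. The matrix of the `h_m` has row and column sums at most `Γ⁻¹`, so Cauchy–Schwarz
bounds that sum by `Γ⁻² ‖δ(f)‖₂²` (`sq_add_sum_mul_le`, `integral_exp_pathMeasure_le`). The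
deviation bound is Chernoff's. No coupling measure is built: expectations are compared by induction
on the number of symbols. -/

open scoped ProbabilityTheory

namespace SCUM

/-! ### Monotonicity of the variations and of the partial products of `Γ`. -/

namespace ProbKernel

variable {A : Type*}

lemma bddAbove_tvSet (g : ProbKernel A) (j : ℕ) :
    BddAbove {v : ℝ | ∃ z z' : Past A, (∀ i < j, z i = z' i) ∧
      v = 1 / 2 * ∑' a, |g.toFun a z - g.toFun a z'|} :=
  ⟨1, by rintro v ⟨z, z', -, rfl⟩; exact g.half_tsum_le_one z z'⟩

lemma half_tsum_le_Var (g : ProbKernel A) {j : ℕ} {z z' : Past A} (h : ∀ i < j, z i = z' i) :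
    1 / 2 * ∑' a, |g.toFun a z - g.toFun a z'| ≤ g.Var j :=
  le_csSup (g.bddAbove_tvSet j) ⟨z, z', h, rfl⟩

lemma Var_antitone (g : ProbKernel A) : Antitone g.Var := by
  intro i j hij
  refine Real.sSup_le ?_ (g.Var_nonneg i)
  rintro v ⟨z, z', h, rfl⟩
  exact g.half_tsum_le_Var fun k hk => h k (hk.trans_le hij)

lemma Gamma_le_prod (g : ProbKernel A) (i : ℕ) :
    g.Gamma ≤ ∏ j ∈ Finset.range i, (1 - g.Var j) := by
  have h0 : ∀ j, 0 ≤ 1 - g.Var j := fun j => by linarith [g.Var_le_one j]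
  have h1 : ∀ j, 1 - g.Var j ≤ 1 := fun j => by linarith [g.Var_nonneg j]
  refine le_of_tendsto g.multipliable_one_sub_Var.hasProd ?_
  rw [SummationFilter.unconditional_filter]
  filter_upwards [Filter.eventually_ge_atTop (Finset.range i)] with s hs
  exact Finset.prod_le_prod_of_subset_of_le_one hs (fun i _ => h0 i) (fun i _ _ => h1 i)

end ProbKernel

/-! ### The house-of-cards chain. -/

/-- `hitProb v i m` is the probability that the house-of-cards chain on `ℕ`, which from `k` falls to
`0` with probability `v k` and otherwise moves to `k + 1`, is at `0` at time `m + 1` when it is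
started at `i`. -/
def hitProb (v : ℕ → ℝ) : ℕ → ℕ → ℝ
  | i, 0 => v i
  | i, m + 1 => (1 - v i) * hitProb v (i + 1) m + v i * hitProb v 0 m

section HitProb

variable {v : ℕ → ℝ}

lemma hitProb_nonneg (h0 : ∀ i, 0 ≤ v i) (h1 : ∀ i, v i ≤ 1) (m i : ℕ) : 0 ≤ hitProb v i m := by
  induction m generalizing i with
  | zero => exact h0 i
  | succ m ih =>
    rw [hitProb]
    exact add_nonneg (mul_nonneg (by linarith [h1 i]) (ih _)) (mul_nonneg (h0 i) (ih _))

/-- A longer agreement makes falls rarer. This ensures that agreeing at a step is never worse than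
disagreeing, as the coupling inequality requires. -/
lemma hitProb_antitone (h1 : ∀ i, v i ≤ 1) (hv : Antitone v) (m : ℕ) :
    Antitone fun i => hitProb v i m := by
  induction m with
  | zero => exact hv
  | succ m ih =>
    refine antitone_nat_of_succ_le fun i => ?_
    simp only [hitProb]
    have a1 : hitProb v (i + 1 + 1) m ≤ hitProb v (i + 1) m := ih (Nat.le_succ _)
    have a2 : hitProb v (i + 1 + 1) m ≤ hitProb v 0 m := ih (Nat.zero_le _)
    have a3 : v (i + 1) ≤ v i := hv (Nat.le_succ _)
    have b1 := mul_nonneg (sub_nonneg.2 (h1 i)) (sub_nonneg.2 a1)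
    have b2 := mul_nonneg (sub_nonneg.2 a3) (sub_nonneg.2 a2)
    nlinarith

/-- The expected number of visits to `0` is at most the reciprocal of the escape probability. -/
lemma one_add_sum_hitProb_le (h0 : ∀ i, 0 ≤ v i) {G : ℝ} (hG : 0 < G)
    (hGv : ∀ i, G ≤ ∏ j ∈ Finset.range i, (1 - v j)) (L : ℕ) :
    1 + ∑ m ∈ Finset.range L, hitProb v 0 m ≤ G⁻¹ := by
  -- When `G` is the full product, `G / ∏_{j<i} (1 - v j)` is the probability of never falling from
  -- `i`, and the expected number of falls is the probability of a first fall divided by the escape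
  -- probability `G`.
  have key : ∀ i, G * ∑ m ∈ Finset.range L, hitProb v i m ≤
      1 - G / ∏ j ∈ Finset.range i, (1 - v j) := by
    induction L with
    | zero =>
      intro i
      simp only [Finset.range_zero, Finset.sum_empty, mul_zero, sub_nonneg]
      exact (div_le_one (hG.trans_le (hGv i))).2 (hGv i)
    | succ L ih =>
      intro i
      have hp := hG.trans_le (hGv i)
      have hp' := hG.trans_le (hGv (i + 1))
      have hi : 0 < 1 - v i := by
        rw [Finset.prod_range_succ] at hp'
        exact pos_of_mul_pos_right hp' hp.le
      have e1 := ih (i + 1)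
      have e0 := ih 0
      rw [Finset.prod_range_succ] at e1
      rw [Finset.prod_range_zero, div_one] at e0
      rw [Finset.sum_range_succ']
      simp only [hitProb, Finset.sum_add_distrib, ← Finset.mul_sum]
      set P := ∏ j ∈ Finset.range i, (1 - v j)
      have e2 : (1 - v i) * (G / (P * (1 - v i))) = G / P := by field_simp
      have f1 := mul_le_mul_of_nonneg_left e1 hi.le
      have f0 := mul_le_mul_of_nonneg_left e0 (h0 i)
      rw [mul_sub, e2] at f1
      linarith
  have := key 0
  rw [Finset.prod_range_zero, div_one] at this
  rw [← one_div, le_div_iff₀ hG]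
  linarith

end HitProb

/-! ### Coupling inequality for a single step. -/

/-- A one-sided form of the coupling inequality for two laws at total variation distance at
most `V`. -/
lemma tsum_mul_sub_tsum_mul_le {ι : Type*} {p q H H' : ι → ℝ} (hp0 : ∀ a, 0 ≤ p a)
    (hq0 : ∀ a, 0 ≤ q a) (hp : HasSum p 1) (hq : HasSum q 1) {V X D C : ℝ}
    (hV : 1 / 2 * ∑' a, |p a - q a| ≤ V) (hXD : X ≤ D) (hH : ∀ a, |H a| ≤ C)
    (hH' : ∀ a, |H' a| ≤ C) (h1 : ∀ a, H a - H' a ≤ X) (h2 : ∀ a b, H a - H' b ≤ D) :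
    ∑' a, p a * H a - ∑' a, q a * H' a ≤ (1 - V) * X + V * D := by
  have hne : Nonempty ι := by
    by_contra h
    rw [not_nonempty_iff] at h
    have := hp.unique hasSum_empty
    norm_num at this
  let m : ι → ℝ := fun a => min (p a) (q a)
  have hm0 : ∀ a, 0 ≤ m a := fun a => le_min (hp0 a) (hq0 a)
  have hms : Summable m := hp.summable.of_nonneg_of_le hm0 fun a => min_le_left _ _
  have hr0 : ∀ a, 0 ≤ p a - m a := fun a => sub_nonneg.2 (min_le_left _ _)
  have hs0 : ∀ a, 0 ≤ q a - m a := fun a => sub_nonneg.2 (min_le_right _ _)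
  have bdd : ∀ {r K : ι → ℝ}, Summable r → (∀ a, 0 ≤ r a) → (∀ a, |K a| ≤ C) →
      Summable fun a => r a * K a := by
    intro r K hr hr0 hK
    refine Summable.of_norm_bounded (hr.mul_right C) fun a => ?_
    rw [Real.norm_eq_abs, abs_mul, abs_of_nonneg (hr0 a)]
    exact mul_le_mul_of_nonneg_left (hK a) (hr0 a)
  -- `m` is the mass the optimal coupling keeps on the diagonal; both residues `p - m` and `q - m`
  -- have mass `τ`, the total variation distance.
  set τ := 1 - ∑' a, m a with hτ
  have hrs : HasSum (fun a => p a - m a) τ := hp.sub hms.hasSum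
  have hss : HasSum (fun a => q a - m a) τ := hq.sub hms.hasSum
  have hτV : τ ≤ V := by
    have e : ∀ a, |p a - q a| = p a + q a - 2 * m a := by
      intro a
      rcases le_total (p a) (q a) with h | h
      · simp only [m, min_eq_left h, abs_of_nonpos (sub_nonpos.2 h)]; ring
      · simp only [m, min_eq_right h, abs_of_nonneg (sub_nonneg.2 h)]; ring
    have := ((hp.add hq).sub (hms.hasSum.mul_left 2)).tsum_eq
    simp only [e, this] at hV
    linarith
  have hbH : BddAbove (Set.range H) := ⟨C, by rintro _ ⟨a, rfl⟩; exact (abs_le.1 (hH a)).2⟩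
  -- The level `c` separates the two residues, `H ≤ c` and `H' ≥ c - D`, so no joint law of the
  -- residues is needed.
  set c := ⨆ a, H a
  have hc1 : ∀ a, H a ≤ c := fun a => le_ciSup hbH a
  have hc2 : ∀ b, c - D ≤ H' b := fun b => by
    have : c ≤ H' b + D := ciSup_le fun a => by linarith [h2 a b]
    linarith
  have t1 : ∑' a, m a * H a - ∑' a, m a * H' a ≤ (1 - τ) * X := by
    rw [← (bdd hms hm0 hH).tsum_sub (bdd hms hm0 hH')]
    have : (1 - τ) * X = ∑' a, m a * X := by rw [tsum_mul_right, hτ]; ring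
    rw [this]
    refine Summable.tsum_le_tsum (fun a => ?_)
      ((bdd hms hm0 hH).sub (bdd hms hm0 hH')) (hms.mul_right X)
    rw [← mul_sub]
    exact mul_le_mul_of_nonneg_left (h1 a) (hm0 a)
  have t2 : ∑' a, (p a - m a) * H a ≤ τ * c := by
    rw [← (hrs.mul_right c).tsum_eq]
    exact Summable.tsum_le_tsum (fun a => mul_le_mul_of_nonneg_left (hc1 a) (hr0 a))
      (bdd hrs.summable hr0 hH) (hrs.summable.mul_right c)
  have t3 : τ * (c - D) ≤ ∑' a, (q a - m a) * H' a := by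
    rw [← (hss.mul_right (c - D)).tsum_eq]
    exact Summable.tsum_le_tsum (fun a => mul_le_mul_of_nonneg_left (hc2 a) (hs0 a))
      (hss.summable.mul_right (c - D)) (bdd hss.summable hs0 hH')
  have e1 : ∑' a, p a * H a = ∑' a, m a * H a + ∑' a, (p a - m a) * H a := by
    rw [← (bdd hms hm0 hH).tsum_add (bdd hrs.summable hr0 hH)]
    exact tsum_congr fun a => by ring
  have e2 : ∑' a, q a * H' a = ∑' a, m a * H' a + ∑' a, (q a - m a) * H' a := by
    rw [← (bdd hms hm0 hH').tsum_add (bdd hss.summable hs0 hH')]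
    exact tsum_congr fun a => by ring
  rw [e1, e2]
  -- Since `X ≤ D`, the bound `(1 - τ) X + τ D` increases when `τ` is replaced by `V`.
  nlinarith [mul_nonneg (sub_nonneg.2 hτV) (sub_nonneg.2 hXD)]

/-! ### Functions with bounded oscillations. -/

/-- `d j` bounds the oscillation of `f` in the coordinate `j`. -/
def OscBound {A : Type*} {L : ℕ} (f : (Fin L → A) → ℝ) (d : Fin L → ℝ) : Prop :=
  ∀ (j : Fin L) (ω : Fin L → A) (a b : A),
    f (Function.update ω j a) - f (Function.update ω j b) ≤ d j

namespace OscBound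

variable {A : Type*} {L : ℕ}

lemma nonneg {f : (Fin L → A) → ℝ} {d : Fin L → ℝ} (h : OscBound f d) (ω : Fin L → A)
    (j : Fin L) : 0 ≤ d j := by
  simpa using h j ω (ω j) (ω j)

lemma cons {f : (Fin (L + 1) → A) → ℝ} {d : Fin (L + 1) → ℝ} (h : OscBound f d) (a : A) :
    OscBound (fun σ : Fin L → A => f (Fin.cons a σ)) fun j => d j.succ := by
  intro j ω b c
  simpa only [Fin.cons_update] using h j.succ (Fin.cons a ω) b c

lemma cons_sub_cons_le {f : (Fin (L + 1) → A) → ℝ} {d : Fin (L + 1) → ℝ} (h : OscBound f d)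
    (a b : A) (σ : Fin L → A) : f (Fin.cons a σ) - f (Fin.cons b σ) ≤ d 0 := by
  have := h 0 (Fin.cons a σ) a b
  rwa [Fin.update_cons_zero, Fin.update_cons_zero] at this

lemma sub_le_sum {f : (Fin L → A) → ℝ} {d : Fin L → ℝ} (h : OscBound f d) (σ τ : Fin L → A) :
    f σ - f τ ≤ ∑ j, d j := by
  induction L with
  | zero => simp [Subsingleton.elim σ τ]
  | succ L ih =>
    have h1 := ih (h.cons (σ 0)) (Fin.tail σ) (Fin.tail τ)
    have h2 := h.cons_sub_cons_le (σ 0) (τ 0) (Fin.tail τ)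
    simp only [Fin.cons_self_tail] at h1 h2
    rw [Fin.sum_univ_succ]
    linarith

/-- Finitely many finite oscillations make `f` bounded; all integrability below rests on this. -/
lemma exists_abs_le {f : (Fin L → A) → ℝ} {d : Fin L → ℝ} (h : OscBound f d) :
    ∃ C, ∀ σ, |f σ| ≤ C := by
  rcases isEmpty_or_nonempty (Fin L → A) with he | ⟨⟨τ⟩⟩
  · exact ⟨0, fun σ => he.elim σ⟩
  · refine ⟨|f τ| + ∑ j, d j, fun σ => ?_⟩
    have h1 := h.sub_le_sum σ τ
    have h2 := h.sub_le_sum τ σ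
    rw [abs_le]
    constructor <;> linarith [neg_abs_le (f τ), le_abs_self (f τ)]

end OscBound

end SCUM

/-! ### Laws of finite blocks, built from the first symbol onwards. -/

namespace SCUM

/-- The past `x a`, obtained from `x` by appending the symbol `a`. -/
def Past.push {A : Type*} (x : Past A) (a : A) : Past A
  | 0 => a
  | i + 1 => x i

lemma Past.concat_succ {A : Type*} (x : Past A) {n : ℕ} (σ : Fin (n + 1) → A) :
    x.concat σ = (x.push (σ 0)).concat (Fin.tail σ) := by
  funext i
  simp only [Past.concat, Fin.tail]
  split_ifs with h1 h2 h2
  · congr 1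
    ext
    simp only [Fin.val_succ]
    omega
  · obtain rfl : i = n := by omega
    rw [Nat.sub_self, Past.push]
    congr 1
    ext
    simp
  · omega
  · have : i - n = i - (n + 1) + 1 := by omega
    rw [this, Past.push]

namespace ProbKernel

variable {A : Type*} [Countable A] [MeasurableSpace A] [DiscreteMeasurableSpace A]

/-- The law of the first `L` symbols of the chain started with the past `z`. -/
noncomputable def pathMeasure (g : ProbKernel A) : (L : ℕ) → Past A → Measure (Fin L → A)
  | 0, _ => Measure.dirac Fin.elim0
  | L + 1, z => ((g.stepPMF z).toMeasure ⊗ₘ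
      (⟨fun a => pathMeasure g L (z.push a), measurable_of_countable _⟩ :
        ProbabilityTheory.Kernel A (Fin L → A))).map
      fun p => (Fin.cons p.1 p.2 : Fin (L + 1) → A)

/-- The law of the symbols at times `1, …, L`, given the one at time `0`. -/
noncomputable def pathKernel (g : ProbKernel A) (L : ℕ) (z : Past A) :
    ProbabilityTheory.Kernel A (Fin L → A) :=
  ⟨fun a => g.pathMeasure L (z.push a), measurable_of_countable _⟩

lemma pathMeasure_succ (g : ProbKernel A) (L : ℕ) (z : Past A) :
    g.pathMeasure (L + 1) z = ((g.stepPMF z).toMeasure ⊗ₘ g.pathKernel L z).map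
      fun p => (Fin.cons p.1 p.2 : Fin (L + 1) → A) := rfl

instance (g : ProbKernel A) (L : ℕ) (z : Past A) : IsProbabilityMeasure (g.pathMeasure L z) := by
  induction L generalizing z with
  | zero => rw [pathMeasure]; infer_instance
  | succ L ih =>
    have : ProbabilityTheory.IsMarkovKernel (g.pathKernel L z) := ⟨fun a => ih _⟩
    have : IsProbabilityMeasure (g.stepPMF z).toMeasure := PMF.toMeasure.isProbabilityMeasure _
    rw [pathMeasure_succ]
    exact Measure.isProbabilityMeasure_map (measurable_of_countable _).aemeasurable

instance (g : ProbKernel A) (L : ℕ) (z : Past A) :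
    ProbabilityTheory.IsMarkovKernel (g.pathKernel L z) :=
  ⟨fun a => inferInstanceAs (IsProbabilityMeasure (g.pathMeasure L (z.push a)))⟩

instance (g : ProbKernel A) (z : Past A) : IsProbabilityMeasure (g.stepPMF z).toMeasure :=
  PMF.toMeasure.isProbabilityMeasure _

lemma pathMeasure_singleton (g : ProbKernel A) (L : ℕ) (z : Past A) (τ : ℕ → A) :
    g.pathMeasure L z {fun i : Fin L => τ i} = ∏ j ∈ Finset.range L,
      ENNReal.ofReal (g.toFun (τ j) (z.concat fun i : Fin j => τ i)) := by
  induction L generalizing z τ with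
  | zero =>
    rw [pathMeasure, Finset.prod_range_zero, Subsingleton.elim (fun i : Fin 0 => τ i) Fin.elim0]
    simp
  | succ L ih =>
    have hset : (fun p : A × (Fin L → A) => (Fin.cons p.1 p.2 : Fin (L + 1) → A)) ⁻¹'
        {fun i : Fin (L + 1) => τ i} = {τ 0} ×ˢ {fun i : Fin L => τ (i + 1)} := by
      ext ⟨a, σ⟩
      simp only [Set.mem_preimage, Set.mem_singleton_iff, Set.mem_prod]
      constructor
      · intro h
        exact ⟨congrFun h 0, funext fun i => congrFun h i.succ⟩
      · rintro ⟨rfl, rfl⟩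
        funext i
        refine Fin.cases ?_ (fun i => ?_) i <;> simp
    rw [pathMeasure_succ, Measure.map_apply (measurable_of_countable _)
      (measurableSet_singleton _), hset, Measure.compProd_apply_prod
      (measurableSet_singleton _) (measurableSet_singleton _), lintegral_singleton,
      PMF.toMeasure_apply_singleton _ _ (measurableSet_singleton _)]
    change g.pathMeasure L (z.push (τ 0)) _ * _ = _
    rw [ih (z.push (τ 0)) fun i => τ (i + 1), Finset.prod_range_succ']
    congr 1
    · refine Finset.prod_congr rfl fun j _ => ?_
      rw [Past.concat_succ]
      rfl

/-- The Ionescu-Tulcea construction appends symbols at the end, while the inductions below peel off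
the first one. Both laws live on a countable space and give the same mass to each string. -/
lemma map_pastMeasure (g : ProbKernel A) (n : ℕ) (x : Past A) :
    (g.pastMeasure x).map (fun ω => fun i : Fin (n + 1) => ω i) = g.pathMeasure (n + 1) x := by
  refine Measure.ext_of_singleton fun σ => ?_
  -- The values of `τ` beyond `n` are arbitrary.
  obtain ⟨τ, rfl⟩ : ∃ τ : ℕ → A, σ = fun i : Fin (n + 1) => τ i :=
    ⟨fun i => if h : i < n + 1 then σ ⟨i, h⟩ else σ 0, by funext i; simp [i.2]⟩
  rw [Measure.map_apply (by fun_prop) (measurableSet_singleton _), pathMeasure_singleton,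
    ← pastMeasure_cylinder]
  congr 1
  ext ω
  simp only [Set.mem_preimage, Set.mem_singleton_iff, Set.mem_ofPred_eq]
  constructor
  · intro h i hi
    exact congrFun h ⟨i, Nat.lt_succ_iff.2 hi⟩
  · intro h
    exact funext fun i => h i (Nat.lt_succ_iff.1 i.2)

lemma integral_stepPMF (g : ProbKernel A) (z : Past A) {H : A → ℝ} {C : ℝ} (hH : ∀ a, |H a| ≤ C) :
    ∫ a, H a ∂(g.stepPMF z).toMeasure = ∑' a, g.toFun a z * H a := by
  rw [PMF.integral_eq_tsum _ _ (Integrable.of_bound (measurable_of_countable _).aestronglyMeasurable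
    C (ae_of_all _ hH))]
  refine tsum_congr fun a => ?_
  rw [smul_eq_mul]
  congr 1
  exact ENNReal.toReal_ofReal (g.nonneg a z)

lemma integral_pathMeasure_succ (g : ProbKernel A) (L : ℕ) (z : Past A)
    {f : (Fin (L + 1) → A) → ℝ} {C : ℝ} (hf : ∀ σ, |f σ| ≤ C) :
    ∫ σ, f σ ∂g.pathMeasure (L + 1) z =
      ∫ a, ∫ σ, f (Fin.cons a σ) ∂g.pathMeasure L (z.push a) ∂(g.stepPMF z).toMeasure := by
  rw [pathMeasure_succ, integral_map (measurable_of_countable _).aemeasurable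
    (measurable_of_countable _).aestronglyMeasurable, Measure.integral_compProd]
  · rfl
  · exact Integrable.of_bound (measurable_of_countable _).aestronglyMeasurable C
      (ae_of_all _ fun p => hf _)

lemma integrable_pathMeasure (g : ProbKernel A) {L : ℕ} (z : Past A)
    {f : (Fin L → A) → ℝ} {C : ℝ} (hf : ∀ σ, |f σ| ≤ C) : Integrable f (g.pathMeasure L z) :=
  Integrable.of_bound (measurable_of_countable _).aestronglyMeasurable C (ae_of_all _ fun σ => hf σ)

lemma abs_integral_pathMeasure_le (g : ProbKernel A) {L : ℕ} (z : Past A)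
    {f : (Fin L → A) → ℝ} {C : ℝ} (hf : ∀ σ, |f σ| ≤ C) :
    |∫ σ, f σ ∂g.pathMeasure L z| ≤ C := by
  simpa using norm_integral_le_of_norm_le_const (μ := g.pathMeasure L z) (f := f)
    (ae_of_all _ fun σ => hf σ)

lemma integral_cons_sub_integral_cons_le (g : ProbKernel A) {L : ℕ} {f : (Fin (L + 1) → A) → ℝ}
    {d : Fin (L + 1) → ℝ} (hf : OscBound f d) (a b : A) (z : Past A) :
    ∫ σ, f (Fin.cons a σ) ∂g.pathMeasure L z - ∫ σ, f (Fin.cons b σ) ∂g.pathMeasure L z ≤ d 0 := by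
  obtain ⟨C, hC⟩ := hf.exists_abs_le
  have hi : ∀ c, Integrable (fun σ => f (Fin.cons c σ)) (g.pathMeasure L z) := fun c =>
    g.integrable_pathMeasure _ fun σ => hC _
  rw [← integral_sub (hi a) (hi b)]
  refine (integral_mono ((hi a).sub (hi b)) (integrable_const (d 0))
    fun σ => hf.cons_sub_cons_le a b σ).trans ?_
  simp

/-- Changing the past beyond its last `i` symbols changes expectations of `f` at most by the
oscillations of `f`, weighted by the house-of-cards hitting probabilities. -/
lemma integral_sub_integral_le (g : ProbKernel A) {L : ℕ} {f : (Fin L → A) → ℝ} {d : Fin L → ℝ}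
    (hf : OscBound f d) {i : ℕ} {z z' : Past A} (h : ∀ k < i, z k = z' k) :
    ∫ σ, f σ ∂g.pathMeasure L z - ∫ σ, f σ ∂g.pathMeasure L z' ≤
      ∑ m : Fin L, hitProb g.Var i m * d m := by
  induction L generalizing i z z' with
  | zero => simp [pathMeasure]
  | succ L ih =>
    obtain ⟨C, hC⟩ := hf.exists_abs_le
    have hd := hf.nonneg fun _ => z 0
    have hH : ∀ (y : Past A) a, |∫ σ, f (Fin.cons a σ) ∂g.pathMeasure L (y.push a)| ≤ C :=
      fun y a => g.abs_integral_pathMeasure_le _ fun σ => hC _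
    have hle : ∑ m : Fin L, hitProb g.Var (i + 1) m * d m.succ ≤
        ∑ m : Fin L, hitProb g.Var 0 m * d m.succ :=
      Finset.sum_le_sum fun m _ => mul_le_mul_of_nonneg_right
        (hitProb_antitone g.Var_le_one g.Var_antitone m (Nat.zero_le _)) (hd _)
    -- Equal next symbols lengthen the agreement from `i` to `i + 1`.
    have h1 : ∀ a, ∫ σ, f (Fin.cons a σ) ∂g.pathMeasure L (z.push a) -
        ∫ σ, f (Fin.cons a σ) ∂g.pathMeasure L (z'.push a) ≤
          ∑ m : Fin L, hitProb g.Var (i + 1) m * d m.succ := fun a =>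
      ih (hf.cons a) fun k hk => by
        cases k with
        | zero => rfl
        | succ k => exact h k (Nat.lt_of_succ_lt_succ hk)
    -- Different next symbols cost `d 0` and reset the agreement length to `0`.
    have h2 : ∀ a b, ∫ σ, f (Fin.cons a σ) ∂g.pathMeasure L (z.push a) -
        ∫ σ, f (Fin.cons b σ) ∂g.pathMeasure L (z'.push b) ≤
          d 0 + ∑ m : Fin L, hitProb g.Var 0 m * d m.succ := by
      intro a b
      have e1 := ih (i := 0) (z := z.push a) (z' := z'.push b) (hf.cons a) (by simp)
      have e2 := g.integral_cons_sub_integral_cons_le hf a b (z'.push b)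
      linarith
    rw [g.integral_pathMeasure_succ L z hC, g.integral_pathMeasure_succ L z' hC,
      g.integral_stepPMF z (hH z), g.integral_stepPMF z' (hH z')]
    refine (tsum_mul_sub_tsum_mul_le (fun a => g.nonneg a z) (fun a => g.nonneg a z')
      (g.hasSum_one z) (g.hasSum_one z') (g.half_tsum_le_Var h) (hle.trans ?_) (hH z) (hH z')
      h1 h2).trans_eq ?_
    · linarith [hd 0]
    · rw [Fin.sum_univ_succ]
      simp only [Fin.val_zero, Fin.val_succ, hitProb, add_mul, mul_assoc, Finset.sum_add_distrib,
        ← Finset.mul_sum]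
      ring

/-! ### Exponential moments of finite blocks. -/

/-- The expected number of visits to `0` up to time `k` of the house-of-cards chain started at `0`. -/
def visitWeight (v : ℕ → ℝ) (k : ℕ) : ℝ := 1 + ∑ m ∈ Finset.range k, hitProb v 0 m

/-- Cauchy–Schwarz with weights `1, h_0, h_1, …` of total mass at most `U`. As `visitWeight v (j +
1) = visitWeight v j + h_j`, the weighted sum of squares for `d` pays for the square at the first
coordinate and leaves the same weighted sum for the shifted `d`, which closes the induction over the
symbols. -/
lemma sq_add_sum_mul_le {L : ℕ} {v : ℕ → ℝ} (hv : ∀ m, 0 ≤ hitProb v 0 m) {U : ℝ}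
    (hU : visitWeight v L ≤ U) (d : Fin (L + 1) → ℝ) :
    (d 0 + ∑ m : Fin L, hitProb v 0 m * d m.succ) ^ 2 +
        U * ∑ j : Fin L, visitWeight v j * d j.succ ^ 2 ≤
      U * ∑ j : Fin (L + 1), visitWeight v j * d j ^ 2 := by
  have hcs := Finset.sum_sq_le_sum_mul_sum_of_sq_le_mul (Finset.univ : Finset (Fin (L + 1)))
    (r := Fin.cons (d 0) fun m : Fin L => hitProb v 0 m * d m.succ)
    (f := Fin.cons 1 fun m : Fin L => hitProb v 0 m)
    (g := Fin.cons (d 0 ^ 2) fun m : Fin L => hitProb v 0 m * d m.succ ^ 2)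
    (fun i _ => Fin.cases (by simp) (fun m => by simpa using hv m) i)
    (fun i _ => Fin.cases (by simpa using sq_nonneg (d 0))
      (fun m => by simpa using mul_nonneg (hv m) (sq_nonneg _)) i)
    (fun i _ => Fin.cases (by simp) (fun m => by simpa using (by ring_nf; rfl)) i)
  simp only [Fin.sum_univ_succ, Fin.cons_zero, Fin.cons_succ] at hcs
  rw [Fin.sum_univ_eq_sum_range (fun m => hitProb v 0 m)] at hcs
  have hstep : ∀ j : Fin L, visitWeight v j.succ * d j.succ ^ 2 =
      hitProb v 0 j * d j.succ ^ 2 + visitWeight v j * d j.succ ^ 2 := by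
    intro j
    simp only [visitWeight, Fin.val_succ, Finset.sum_range_succ]
    ring
  rw [Fin.sum_univ_succ]
  simp only [hstep, Finset.sum_add_distrib]
  have h0 : visitWeight v (0 : Fin (L + 1)) = 1 := by simp [visitWeight]
  have hn : 0 ≤ d 0 ^ 2 + ∑ m : Fin L, hitProb v 0 m * d m.succ ^ 2 :=
    add_nonneg (sq_nonneg _) (Finset.sum_nonneg fun m _ => mul_nonneg (hv m) (sq_nonneg _))
  have := hcs.trans (mul_le_mul_of_nonneg_right hU hn)
  rw [h0]
  linarith

/-- The exponential moment bound, by successive conditioning on the first symbol and Hoeffding's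
lemma. -/
lemma integral_exp_pathMeasure_le (g : ProbKernel A) {U : ℝ} (hU : ∀ k, visitWeight g.Var k ≤ U)
    {L : ℕ} {f : (Fin L → A) → ℝ} {d : Fin L → ℝ} (hf : OscBound f d) (θ : ℝ) (z : Past A) :
    ∫ σ, Real.exp (θ * (f σ - ∫ η, f η ∂g.pathMeasure L z)) ∂g.pathMeasure L z ≤
      Real.exp (θ ^ 2 / 8 * (U * ∑ j : Fin L, visitWeight g.Var j * d j ^ 2)) := by
  induction L generalizing z with
  | zero => simp [pathMeasure]
  | succ L ih =>
    obtain ⟨C, hC⟩ := hf.exists_abs_le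
    have hd := hf.nonneg fun _ => z 0
    have hw : ∀ m, 0 ≤ hitProb g.Var 0 m := fun m => hitProb_nonneg g.Var_nonneg g.Var_le_one m 0
    set E := ∫ η, f η ∂g.pathMeasure (L + 1) z with hE
    set H : A → ℝ := fun a => ∫ σ, f (Fin.cons a σ) ∂g.pathMeasure L (z.push a) with hHdef
    have hH : ∀ a, |H a| ≤ C := fun a => g.abs_integral_pathMeasure_le _ fun σ => hC _
    have hEH : E = ∫ a, H a ∂(g.stepPMF z).toMeasure := g.integral_pathMeasure_succ L z hC
    set X := ∑ m : Fin L, hitProb g.Var 0 m * d m.succ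
    have hosc : ∀ a b, H a - H b ≤ d 0 + X := by
      intro a b
      have e1 := g.integral_sub_integral_le (i := 0) (z := z.push a) (z' := z.push b)
        (hf.cons a) (by simp)
      have e2 := g.integral_cons_sub_integral_cons_le hf a b (z.push b)
      simp only [hHdef]
      linarith
    have hne : Nonempty A := ⟨z 0⟩
    have hbdd : BddBelow (Set.range H) := ⟨-C, by rintro _ ⟨a, rfl⟩; exact (abs_le.1 (hH a)).1⟩
    -- Hoeffding's lemma needs an interval of length `d 0 + X`; anchoring it at the infimum
    -- suffices.
    have hmem : ∀ a, H a ∈ Set.Icc (⨅ b, H b) ((⨅ b, H b) + (d 0 + X)) := by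
      refine fun a => ⟨ciInf_le hbdd a, ?_⟩
      have : H a - (d 0 + X) ≤ ⨅ b, H b := le_ciInf fun b => by linarith [hosc a b]
      linarith
    have hoeff := (ProbabilityTheory.hasSubgaussianMGF_of_mem_Icc
      (μ := (g.stepPMF z).toMeasure) (measurable_of_countable H).aemeasurable
      (ae_of_all _ hmem)).mgf_le θ
    rw [ProbabilityTheory.mgf, ← hEH, add_sub_cancel_left] at hoeff
    have hint := (ProbabilityTheory.hasSubgaussianMGF_of_mem_Icc
      (μ := (g.stepPMF z).toMeasure) (measurable_of_countable H).aemeasurable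
      (ae_of_all _ hmem)).integrable_exp_mul θ
    rw [← hEH] at hint
    set B := U * ∑ j : Fin L, visitWeight g.Var j * d j.succ ^ 2
    have hCE : |E| ≤ C := g.abs_integral_pathMeasure_le z hC
    have hexp : ∀ σ, |Real.exp (θ * (f σ - E))| ≤ Real.exp (|θ| * (2 * C)) := by
      intro σ
      rw [Real.abs_exp, Real.exp_le_exp]
      refine (le_abs_self _).trans ?_
      rw [abs_mul]
      refine mul_le_mul_of_nonneg_left ?_ (abs_nonneg _)
      exact (abs_sub _ _).trans (by linarith [hC σ])
    have hin : ∀ a, ∫ σ, Real.exp (θ * (f (Fin.cons a σ) - E)) ∂g.pathMeasure L (z.push a) ≤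
        Real.exp (θ * (H a - E)) * Real.exp (θ ^ 2 / 8 * B) := by
      intro a
      have : ∀ σ, Real.exp (θ * (f (Fin.cons a σ) - E)) =
          Real.exp (θ * (H a - E)) * Real.exp (θ * (f (Fin.cons a σ) - H a)) := by
        intro σ
        rw [← Real.exp_add]
        ring_nf
      simp only [this, integral_const_mul]
      exact mul_le_mul_of_nonneg_left (ih (hf.cons a) (z.push a)) (Real.exp_pos _).le
    rw [g.integral_pathMeasure_succ L z hexp]
    have hi1 : Integrable (fun a => ∫ σ, Real.exp (θ * (f (Fin.cons a σ) - E))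
        ∂g.pathMeasure L (z.push a)) (g.stepPMF z).toMeasure :=
      Integrable.of_bound (measurable_of_countable _).aestronglyMeasurable
        (Real.exp (|θ| * (2 * C)))
        (ae_of_all _ fun a => g.abs_integral_pathMeasure_le _ fun σ => hexp _)
    refine (integral_mono hi1 (hint.mul_const _) hin).trans ?_
    rw [integral_mul_const]
    refine (mul_le_mul_of_nonneg_right hoeff (Real.exp_pos _).le).trans ?_
    rw [← Real.exp_add, Real.exp_le_exp]
    have hkey := mul_le_mul_of_nonneg_left (sq_add_sum_mul_le hw (hU L) d)
      (show 0 ≤ θ ^ 2 / 8 by positivity)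
    -- Hoeffding's variance proxy is `((d 0 + X) / 2)²`, which contributes `θ² / 8 * (d 0 + X)²`.
    refine le_trans (le_of_eq ?_) hkey
    simp only [NNReal.coe_pow, NNReal.coe_div, coe_nnnorm, Real.norm_eq_abs, NNReal.coe_ofNat,
      div_pow, sq_abs]
    ring

end ProbKernel
end SCUM

/-! ### Transfer to `P^x` and the deviation bound. -/

namespace SCUM

lemma FiniteOsc.oscBound {A : Type*} {n : ℕ} {f : (Fin (n + 1) → A) → ℝ} (hf : FiniteOsc f) :
    OscBound f (delta f) := fun j ω a b =>
  (le_abs_self _).trans (le_csSup (hf j) ⟨ω, a, b, rfl⟩)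

lemma eq_of_deltaSq_eq_zero {A : Type*} {n : ℕ} {f : (Fin (n + 1) → A) → ℝ} (hf : FiniteOsc f)
    (h : deltaSq f = 0) (σ τ : Fin (n + 1) → A) : f σ = f τ := by
  have hd : ∀ j, delta f j = 0 := fun j => by
    simpa using (Finset.sum_eq_zero_iff_of_nonneg fun j _ => sq_nonneg (delta f j)).1 h j
      (Finset.mem_univ j)
  have h1 := hf.oscBound.sub_le_sum σ τ
  have h2 := hf.oscBound.sub_le_sum τ σ
  simp only [hd, Finset.sum_const_zero] at h1 h2
  linarith

namespace ProbKernel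

lemma visitWeight_le {A : Type*} (g : ProbKernel A) (hg : 0 < g.Gamma) (k : ℕ) :
    visitWeight g.Var k ≤ g.Gamma⁻¹ :=
  one_add_sum_hitProb_le g.Var_nonneg hg g.Gamma_le_prod k

variable {A : Type*} [Countable A] [MeasurableSpace A] [DiscreteMeasurableSpace A]

lemma integral_onSeq (g : ProbKernel A) {n : ℕ} (f : (Fin (n + 1) → A) → ℝ) (x : Past A) :
    ∫ ω, onSeq f ω ∂g.pastMeasure x = ∫ σ, f σ ∂g.pathMeasure (n + 1) x := by
  rw [← map_pastMeasure, integral_map (by fun_prop : Measurable _).aemeasurable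
    (measurable_of_countable f).aestronglyMeasurable]
  rfl

lemma integrable_onSeq (g : ProbKernel A) {n : ℕ} {f : (Fin (n + 1) → A) → ℝ} {C : ℝ}
    (hC : ∀ σ, |f σ| ≤ C) (x : Past A) : Integrable (onSeq f) (g.pastMeasure x) :=
  Integrable.of_bound ((measurable_of_countable f).comp (by fun_prop)).aestronglyMeasurable C
    (ae_of_all _ fun _ => hC _)

lemma integral_exp_onSeq_le (g : ProbKernel A) (hg : 0 < g.Gamma) {n : ℕ}
    {f : (Fin (n + 1) → A) → ℝ} (hf : FiniteOsc f) (θ : ℝ) (x : Past A) :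
    Integrable (fun ω => Real.exp (θ * (onSeq f ω - ∫ η, onSeq f η ∂g.pastMeasure x)))
      (g.pastMeasure x) ∧
    ∫ ω, Real.exp (θ * (onSeq f ω - ∫ η, onSeq f η ∂g.pastMeasure x)) ∂g.pastMeasure x ≤
      Real.exp (θ ^ 2 * g.Gamma ^ (-2 : ℤ) / 8 * deltaSq f) := by
  obtain ⟨C, hC⟩ := hf.oscBound.exists_abs_le
  set E := ∫ η, onSeq f η ∂g.pastMeasure x with hE
  have hexp : ∀ σ, |Real.exp (θ * (f σ - E))| ≤ Real.exp (|θ| * (C + |E|)) := by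
    intro σ
    rw [Real.abs_exp, Real.exp_le_exp]
    refine (le_abs_self _).trans ?_
    rw [abs_mul]
    refine mul_le_mul_of_nonneg_left ?_ (abs_nonneg _)
    exact (abs_sub _ _).trans (by linarith [hC σ])
  refine ⟨g.integrable_onSeq hexp x, ?_⟩
  have h1 := g.integral_exp_pathMeasure_le (g.visitWeight_le hg) hf.oscBound θ x
  rw [← integral_onSeq g f x, ← hE,
    ← integral_onSeq g (fun σ => Real.exp (θ * (f σ - E))) x] at h1
  refine h1.trans (Real.exp_le_exp.2 ?_)
  have h2 : ∑ j : Fin (n + 1), visitWeight g.Var j * delta f j ^ 2 ≤ g.Gamma⁻¹ * deltaSq f := by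
    rw [deltaSq, Finset.mul_sum]
    exact Finset.sum_le_sum fun j _ =>
      mul_le_mul_of_nonneg_right (g.visitWeight_le hg j) (sq_nonneg _)
  calc θ ^ 2 / 8 * (g.Gamma⁻¹ * ∑ j : Fin (n + 1), visitWeight g.Var j * delta f j ^ 2)
      ≤ θ ^ 2 / 8 * (g.Gamma⁻¹ * (g.Gamma⁻¹ * deltaSq f)) := by gcongr
    _ = θ ^ 2 * g.Gamma ^ (-2 : ℤ) / 8 * deltaSq f := by
      rw [zpow_neg, zpow_ofNat]
      field_simp

lemma deviation_le (g : ProbKernel A) (hg : 0 < g.Gamma) {n : ℕ}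
    {f : (Fin (n + 1) → A) → ℝ} (hf : FiniteOsc f) {u : ℝ} (hu : 0 < u) (x : Past A) :
    (g.pastMeasure x).real {ω | u < |onSeq f ω - ∫ η, onSeq f η ∂g.pastMeasure x|} ≤
      2 * Real.exp (-(2 * u ^ 2 / (g.Gamma ^ (-2 : ℤ) * deltaSq f))) := by
  set E := ∫ η, onSeq f η ∂g.pastMeasure x
  have hS : 0 ≤ deltaSq f := Finset.sum_nonneg fun j _ => sq_nonneg _
  have hG : 0 < g.Gamma ^ (-2 : ℤ) := zpow_pos hg _
  -- A proxy `c` means a bound `exp (c t² / 2)`, so the factor `1/8` becomes `1/4`.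
  have hsub : ProbabilityTheory.HasSubgaussianMGF (fun ω => onSeq f ω - E)
      (NNReal.mk (g.Gamma ^ (-2 : ℤ) * deltaSq f / 4) (by positivity)) (g.pastMeasure x) :=
    ⟨fun t => (g.integral_exp_onSeq_le hg hf t x).1, fun t =>
      ((g.integral_exp_onSeq_le hg hf t x).2).trans_eq (by rw [NNReal.coe_mk]; ring_nf)⟩
  have h1 := hsub.measure_ge_le hu.le
  have h2 := hsub.neg.measure_ge_le hu.le
  have he : -u ^ 2 / (2 * (g.Gamma ^ (-2 : ℤ) * deltaSq f / 4)) =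
      -(2 * u ^ 2 / (g.Gamma ^ (-2 : ℤ) * deltaSq f)) := by
    -- If `deltaSq f = 0`, both quotients are `0` by the convention for division by zero, and the
    -- stated bound is only `2`.
    rcases hS.eq_or_lt with h | h
    · simp [← h]
    · field_simp
      norm_num
  rw [NNReal.coe_mk, he] at h1 h2
  calc _ ≤ (g.pastMeasure x).real ({ω | u ≤ onSeq f ω - E} ∪
        {ω | u ≤ (-fun ω => onSeq f ω - E) ω}) := by
        refine measureReal_mono fun ω hω => ?_
        rcases lt_abs.1 (show u < |onSeq f ω - E| from hω) with h | h
        · exact Or.inl h.le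
        · exact Or.inr h.le
    _ ≤ _ := measureReal_union_le _ _
    _ ≤ _ := by linarith

end ProbKernel

end SCUM

theorem mainTheorem3 {A : Type*} [Countable A] [MeasurableSpace A] [DiscreteMeasurableSpace A]
    (g : SCUM.ProbKernel A) (hg : 0 < g.Gamma) :
    (∀ x : SCUM.Past A, SCUM.SatisfiesGCB (g.pastMeasure x) (g.Gamma ^ (-2 : ℤ) / 8)) ∧
    ∀ (n : ℕ) (f : (Fin (n + 1) → A) → ℝ), SCUM.FiniteOsc f →
      (∀ (θ : ℝ) (x : SCUM.Past A),
        Integrable (SCUM.onSeq f) (g.pastMeasure x) ∧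
        Integrable (fun ω => Real.exp (θ * (SCUM.onSeq f ω -
          ∫ η, SCUM.onSeq f η ∂(g.pastMeasure x)))) (g.pastMeasure x) ∧
        ∫ ω, Real.exp (θ * (SCUM.onSeq f ω - ∫ η, SCUM.onSeq f η ∂(g.pastMeasure x)))
            ∂(g.pastMeasure x) ≤
          Real.exp (θ ^ 2 * g.Gamma ^ (-2 : ℤ) / 8 * SCUM.deltaSq f)) ∧
      (∀ (u : ℝ), 0 < u → ∀ x : SCUM.Past A,
        (g.pastMeasure x).real
            {ω | u < |SCUM.onSeq f ω - ∫ η, SCUM.onSeq f η ∂(g.pastMeasure x)|} ≤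
          if SCUM.deltaSq f = 0 then 0
          else 2 * Real.exp (-(2 * u ^ 2 / (g.Gamma ^ (-2 : ℤ) * SCUM.deltaSq f)))) := by
  refine ⟨fun x => ⟨div_pos (zpow_pos hg _) (by norm_num), fun n f hf => ?_⟩,
    fun n f hf => ⟨fun θ x => ?_, fun u hu x => ?_⟩⟩
  · obtain ⟨C, hC⟩ := hf.oscBound.exists_abs_le
    have h := g.integral_exp_onSeq_le hg hf 1 x
    simp only [one_mul, one_pow] at h
    exact ⟨g.integrable_onSeq hC x, h⟩
  · obtain ⟨C, hC⟩ := hf.oscBound.exists_abs_le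
    exact ⟨g.integrable_onSeq hC x, g.integral_exp_onSeq_le hg hf θ x⟩
  · split_ifs with h0
    -- Here `f` is constant, so the event is empty; the past `x` merely serves as a point of `ℕ →
    -- A`.
    · have hc : ∀ ω, SCUM.onSeq f ω = SCUM.onSeq f x := fun ω =>
        SCUM.eq_of_deltaSq_eq_zero hf h0 _ _
      simp [hc, not_lt.2 hu.le]
    · exact g.deviation_le hg hf hu x
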